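/- Let $X$ and $Y$ be nonzero Banach spaces over $\mathbb K=\mathbb R$ or $\mathbb C$. For a nonzero Banach space $Z$ and a bounded linear operator $T\in\mathcal L(Z)$, let $$v(T)=\sup\{|z^*(Tz)| : z\in Z,\ z^*\in Z^*,\ \|z\|=\|z^*\|=z^*(z)=1\},\qquad n(Z)=\inf\{v(T): T\in\mathcal L(Z),\ \|T\|=1\}$$ be the numerical radius of $T$ and the numerical index of $Z$. Let $\mathcal N(X,Y)$ be the Banach space of nuclear operators from $X$ to $Y$, that is, of the operators $T$ for which there are $x_n^*\in X^*$ and $y_n\in Y$ ($n\in\mathbb N$) with $\sum_n\|x_n^*\|\,\|y_n\|<\infty$ and $Tx=\sum_n x_n^*(x)\,y_n$ for all $x\in X$, endowed with the norm $N(T)=\inf\sum_n\|x_n^*\|\,\|y_n\|$, where the infimum is over all such representations of $T$. A Banach space $Z$ has the approximation property if for every compact set $K\subset Z$ and every $\varepsilon>0$ there is a bounded finite-rank operator $T\in\mathcal L(Z)$ with $\|Tz-z\|\le\varepsilon$ for all $z\in K$. If $X^*$ or $Y$ has the approximation property, then (a) $n(\mathcal N(X,Y))\le\min\{n(X^*),n(Y)\}$;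 (b) $n(\mathcal N(X,Y)^*)\le\min\{n(X^{**}),n(Y^*)\}$. -/

import Mathlib

noncomputable section

section NumericalIndex

variable (𝕜 : Type*) [RCLike 𝕜] {X : Type*} [NormedAddCommGroup X] [NormedSpace 𝕜 X]

/-- The numerical range `V(T)` of a bounded operator `T` on `X`: the scalars `x⋆ (T x)` where
`x` and `x⋆` are unit vectors of `X` and of its dual with `x⋆ x = 1`. -/
def numericalRange (T : X →L[𝕜] X) : Set 𝕜 :=
  {c | ∃ (x : X) (f : StrongDual 𝕜 X), ‖x‖ = 1 ∧ ‖f‖ = 1 ∧ f x = 1 ∧ c = f (T x)}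

/-- The numerical radius `v(T) = sup {|c| : c ∈ V(T)}`. -/
def numericalRadius (T : X →L[𝕜] X) : ℝ :=
  sSup ((fun c : 𝕜 => ‖c‖) '' numericalRange 𝕜 T)

/-- The numerical index `n(X) = inf {v(T) : T ∈ L(X), ‖T‖ = 1}` of a (nonzero) normed space. -/
def numericalIndex (𝕜 : Type*) [RCLike 𝕜] (X : Type*) [NormedAddCommGroup X] [NormedSpace 𝕜 X] :
    ℝ :=
  sInf {r : ℝ | ∃ T : X →L[𝕜] X, ‖T‖ = 1 ∧ r = numericalRadius 𝕜 T}

end NumericalIndex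

/-- The approximation property: the identity is uniformly approximated on compact sets by
bounded operators of finite rank. -/
def HasApproximationProperty (𝕜 : Type*) [RCLike 𝕜] (Z : Type*) [NormedAddCommGroup Z]
    [NormedSpace 𝕜 Z] : Prop :=
  ∀ K : Set Z, IsCompact K → ∀ ε : ℝ, 0 < ε →
    ∃ T : Z →L[𝕜] Z, FiniteDimensional 𝕜 (LinearMap.range (T : Z →ₗ[𝕜] Z)) ∧
      ∀ z ∈ K, ‖T z - z‖ ≤ ε

section Nuclear

variable {𝕜 : Type*} [RCLike 𝕜] {X : Type*} [NormedAddCommGroup X] [NormedSpace 𝕜 X]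
  {Y : Type*} [NormedAddCommGroup Y] [NormedSpace 𝕜 Y]

/-- `(f, y)` is a nuclear representation of `T`: the series `∑ ‖f n‖ * ‖y n‖` converges and
`T x = ∑ f n x • y n` for all `x`. -/
structure IsNuclearRep (T : X →L[𝕜] Y) (f : ℕ → StrongDual 𝕜 X) (y : ℕ → Y) : Prop where
  summable : Summable fun n => ‖f n‖ * ‖y n‖
  hasSum : ∀ x : X, HasSum (fun n => f n x • y n) (T x)

/-- A nuclear operator is one that admits a nuclear representation. -/
def IsNuclear (T : X →L[𝕜] Y) : Prop :=
  ∃ (f : ℕ → StrongDual 𝕜 X) (y : ℕ → Y), IsNuclearRep T f y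

/-- The values `∑ ‖f n‖ * ‖y n‖` over all nuclear representations of `T`. -/
def nuclearValues (T : X →L[𝕜] Y) : Set ℝ :=
  {r | ∃ (f : ℕ → StrongDual 𝕜 X) (y : ℕ → Y), IsNuclearRep T f y ∧ r = ∑' n, ‖f n‖ * ‖y n‖}

/-- The nuclear norm `N(T)`: the infimum of `∑ ‖f n‖ * ‖y n‖` over all nuclear
representations of `T`. -/
def nuclearNorm (T : X →L[𝕜] Y) : ℝ :=
  sInf (nuclearValues T)

theorem isNuclearRep_zero : IsNuclearRep (0 : X →L[𝕜] Y) (fun _ => 0) (fun _ => 0) :=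
  ⟨by simp [summable_zero], fun x => by simp [hasSum_zero]⟩

theorem IsNuclearRep.smul {T : X →L[𝕜] Y} {f : ℕ → StrongDual 𝕜 X} {y : ℕ → Y}
    (h : IsNuclearRep T f y) (c : 𝕜) : IsNuclearRep (c • T) f (fun n => c • y n) := by
  refine ⟨?_, fun x => ?_⟩
  · refine (h.summable.mul_left ‖c‖).congr fun n => ?_
    rw [norm_smul]; ring
  · refine ((h.hasSum x).const_smul c).congr_fun fun n => ?_
    exact smul_comm _ _ _

theorem IsNuclearRep.exists_add {S T : X →L[𝕜] Y} {f g : ℕ → StrongDual 𝕜 X} {y z : ℕ → Y}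
    (hS : IsNuclearRep S f y) (hT : IsNuclearRep T g z) :
    ∃ (h : ℕ → StrongDual 𝕜 X) (w : ℕ → Y), IsNuclearRep (S + T) h w ∧
      ∑' n, ‖h n‖ * ‖w n‖ = ∑' n, ‖f n‖ * ‖y n‖ + ∑' n, ‖g n‖ * ‖z n‖ := by
  obtain ⟨e⟩ : Nonempty (ℕ ≃ ℕ ⊕ ℕ) := ⟨Equiv.natSumNatEquivNat.symm⟩
  let F : ℕ ⊕ ℕ → StrongDual 𝕜 X := Sum.elim f g
  let W : ℕ ⊕ ℕ → Y := Sum.elim y z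
  have h1 : HasSum (fun i => ‖F i‖ * ‖W i‖)
      (∑' n, ‖f n‖ * ‖y n‖ + ∑' n, ‖g n‖ * ‖z n‖) :=
    HasSum.sum (f := fun i => ‖F i‖ * ‖W i‖) hS.summable.hasSum hT.summable.hasSum
  have h2 : HasSum (fun n => ‖F (e n)‖ * ‖W (e n)‖)
      (∑' n, ‖f n‖ * ‖y n‖ + ∑' n, ‖g n‖ * ‖z n‖) := (e.hasSum_iff).2 h1
  refine ⟨fun n => F (e n), fun n => W (e n), ⟨h2.summable, fun x => ?_⟩, h2.tsum_eq⟩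
  have h3 : HasSum (fun i => F i x • W i) (S x + T x) :=
    HasSum.sum (f := fun i => F i x • W i) (hS.hasSum x) (hT.hasSum x)
  exact (e.hasSum_iff).2 h3

theorem nuclearValues_bddBelow (T : X →L[𝕜] Y) : BddBelow (nuclearValues T) := by
  refine ⟨0, ?_⟩
  rintro r ⟨f, y, -, rfl⟩
  exact tsum_nonneg fun n => by positivity

theorem nuclearNorm_nonneg (T : X →L[𝕜] Y) : 0 ≤ nuclearNorm T := by
  refine Real.sInf_nonneg ?_
  rintro r ⟨f, y, -, rfl⟩
  exact tsum_nonneg fun n => by positivity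

theorem IsNuclear.values_nonempty {T : X →L[𝕜] Y} (h : IsNuclear T) :
    (nuclearValues T).Nonempty := by
  obtain ⟨f, y, h⟩ := h
  exact ⟨_, f, y, h, rfl⟩

theorem IsNuclear.norm_le_nuclearNorm {T : X →L[𝕜] Y} (h : IsNuclear T) :
    ‖T‖ ≤ nuclearNorm T := by
  refine le_csInf h.values_nonempty ?_
  rintro r ⟨f, y, hr, rfl⟩
  refine T.opNorm_le_bound (tsum_nonneg fun n => by positivity) fun x => ?_
  rw [← (hr.hasSum x).tsum_eq, ← tsum_mul_right]
  refine tsum_of_norm_bounded (hr.summable.mul_right ‖x‖).hasSum fun n => ?_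
  rw [norm_smul]
  calc ‖f n x‖ * ‖y n‖ ≤ (‖f n‖ * ‖x‖) * ‖y n‖ := by gcongr; exact (f n).le_opNorm x
    _ = ‖f n‖ * ‖y n‖ * ‖x‖ := by ring

theorem nuclearNorm_zero : nuclearNorm (0 : X →L[𝕜] Y) = 0 := by
  refine le_antisymm (csInf_le (nuclearValues_bddBelow _) ?_) (nuclearNorm_nonneg _)
  exact ⟨_, _, isNuclearRep_zero, by simp⟩

theorem nuclearNorm_add_le {S T : X →L[𝕜] Y} (hS : IsNuclear S) (hT : IsNuclear T) :
    nuclearNorm (S + T) ≤ nuclearNorm S + nuclearNorm T := by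
  rw [← sub_le_iff_le_add]
  refine le_csInf hS.values_nonempty ?_
  rintro r ⟨f, y, hr, rfl⟩
  rw [sub_le_iff_le_add, ← sub_le_iff_le_add']
  refine le_csInf hT.values_nonempty ?_
  rintro s ⟨g, z, hs, rfl⟩
  rw [sub_le_iff_le_add']
  obtain ⟨h, w, hw, he⟩ := hr.exists_add hs
  exact csInf_le (nuclearValues_bddBelow _) ⟨h, w, hw, he.symm⟩

theorem nuclearNorm_smul_le {T : X →L[𝕜] Y} (hT : IsNuclear T) (c : 𝕜) :
    nuclearNorm (c • T) ≤ ‖c‖ * nuclearNorm T := by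
  rcases eq_or_ne c 0 with rfl | hc
  · simp [nuclearNorm_zero]
  have hc' : 0 < ‖c‖ := norm_pos_iff.2 hc
  rw [← div_le_iff₀' hc']
  refine le_csInf hT.values_nonempty ?_
  rintro r ⟨f, y, hr, rfl⟩
  rw [div_le_iff₀' hc']
  refine csInf_le (nuclearValues_bddBelow _) ⟨f, _, hr.smul c, ?_⟩
  rw [← tsum_mul_left]
  refine tsum_congr fun n => ?_
  rw [norm_smul]; ring

variable (𝕜 X Y)

/-- The linear subspace of nuclear operators inside the bounded operators. -/
def nuclearSubmodule : Submodule 𝕜 (X →L[𝕜] Y) where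
  carrier := {T | IsNuclear T}
  zero_mem' := ⟨_, _, isNuclearRep_zero⟩
  add_mem' := by
    rintro S T ⟨f, y, hS⟩ ⟨g, z, hT⟩
    obtain ⟨h, w, hw, -⟩ := hS.exists_add hT
    exact ⟨h, w, hw⟩
  smul_mem' := by
    rintro c T ⟨f, y, hT⟩
    exact ⟨_, _, hT.smul c⟩

/-- The space `N(X, Y)` of nuclear operators. It is a type of its own, so that it carries the
nuclear norm and not the operator norm. -/
def NuclearOperator : Type _ := nuclearSubmodule 𝕜 X Y

instance NuclearOperator.instAddCommGroup : AddCommGroup (NuclearOperator 𝕜 X Y) :=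
  inferInstanceAs (AddCommGroup (nuclearSubmodule 𝕜 X Y))

instance NuclearOperator.instModule : Module 𝕜 (NuclearOperator 𝕜 X Y) :=
  inferInstanceAs (Module 𝕜 (nuclearSubmodule 𝕜 X Y))

/-- The inclusion of the nuclear operators into the bounded operators. -/
def NuclearOperator.toCLM : NuclearOperator 𝕜 X Y →ₗ[𝕜] (X →L[𝕜] Y) :=
  (nuclearSubmodule 𝕜 X Y).subtype

instance NuclearOperator.instNorm : Norm (NuclearOperator 𝕜 X Y) :=
  ⟨fun T => nuclearNorm (NuclearOperator.toCLM 𝕜 X Y T)⟩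

variable {𝕜 X Y}

theorem NuclearOperator.isNuclear (T : NuclearOperator 𝕜 X Y) :
    IsNuclear (NuclearOperator.toCLM 𝕜 X Y T) :=
  Subtype.property (p := fun S => S ∈ nuclearSubmodule 𝕜 X Y) T

theorem NuclearOperator.toCLM_injective :
    Function.Injective (NuclearOperator.toCLM 𝕜 X Y) :=
  (nuclearSubmodule 𝕜 X Y).subtype_injective

theorem NuclearOperator.norm_def (T : NuclearOperator 𝕜 X Y) :
    ‖T‖ = nuclearNorm (NuclearOperator.toCLM 𝕜 X Y T) := rfl

theorem NuclearOperator.norm_smul_le_aux (c : 𝕜) (T : NuclearOperator 𝕜 X Y) :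
    ‖c • T‖ ≤ ‖c‖ * ‖T‖ := by
  rw [NuclearOperator.norm_def, NuclearOperator.norm_def, map_smul]
  exact nuclearNorm_smul_le T.isNuclear c

variable (𝕜 X Y)

theorem NuclearOperator.core : NormedSpace.Core 𝕜 (NuclearOperator 𝕜 X Y) where
  norm_nonneg T := nuclearNorm_nonneg _
  norm_smul c T := by
    refine le_antisymm (NuclearOperator.norm_smul_le_aux c T) ?_
    rcases eq_or_ne c 0 with rfl | hc
    · rw [norm_zero, zero_mul]
      exact nuclearNorm_nonneg _
    have h := NuclearOperator.norm_smul_le_aux c⁻¹ (c • T)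
    rw [smul_smul, inv_mul_cancel₀ hc, one_smul, norm_inv] at h
    rwa [← le_inv_mul_iff₀ (norm_pos_iff.2 hc)]
  norm_triangle S T := by
    rw [NuclearOperator.norm_def, NuclearOperator.norm_def, NuclearOperator.norm_def, map_add]
    exact nuclearNorm_add_le S.isNuclear T.isNuclear
  norm_eq_zero_iff T := by
    constructor
    · intro h
      have h1 := T.isNuclear.norm_le_nuclearNorm
      rw [← NuclearOperator.norm_def, h] at h1
      refine NuclearOperator.toCLM_injective ?_
      rw [map_zero]
      exact norm_le_zero_iff.1 h1
    · rintro rfl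
      rw [NuclearOperator.norm_def, map_zero]
      exact nuclearNorm_zero

instance NuclearOperator.instNormedAddCommGroup : NormedAddCommGroup (NuclearOperator 𝕜 X Y) :=
  NormedAddCommGroup.ofCore (NuclearOperator.core 𝕜 X Y)

instance NuclearOperator.instNormedSpace : NormedSpace 𝕜 (NuclearOperator 𝕜 X Y) :=
  NormedSpace.ofCore (NuclearOperator.core 𝕜 X Y)

end Nuclear

end

noncomputable section

/-! ### Numerical radii and unital maps between operator algebras. -/

section NumericalIndexComparison

variable {𝕜 : Type*} [RCLike 𝕜] {E : Type*} [NormedAddCommGroup E] [NormedSpace 𝕜 E]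
  {F : Type*} [NormedAddCommGroup F] [NormedSpace 𝕜 F]

/-! The numerical radius of `T` depends only on the norm and the unit of the algebra of operators:
it is the supremum, over unimodular `w`, of the right derivative of `a ↦ ‖1 + a w T‖` at `0`
(Lumer). Hence a unital linear isometry from `L(E)` into `L(F)` gives `n(F) ≤ n(E)`
(`numericalIndex_le_of_unital`), and each of the four bounds comes from such an embedding.

For (a), `S ↦ S ⊗ 1` and `R ↦ 1 ⊗ R` embed `L(X*)` and `L(Y)` into `L(N(X,Y))`. For (b), `N(X,Y)*`
is isometric to `L(X*, Y*)`, hence by flipping to `L(Y, X**)`, and composition on the left embeds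
`L(E)` into `L(L(F, E))`.

Both parts need a bounded bilinear map on `X* × Y` to induce an operator on `N(X,Y)`, that is, its
sum along a nuclear representation must depend only on the operator represented. This is where the
approximation property enters (`HasApproximationProperty.tsum_bilinear_eq_zero`). The norms are then
read off from rank one operators, since `N(f ⊗ y) = ‖f‖ ‖y‖`. -/

theorem bddAbove_norm_numericalRange (T : E →L[𝕜] E) :
    BddAbove ((fun c : 𝕜 => ‖c‖) '' numericalRange 𝕜 T) := by
  refine ⟨‖T‖, ?_⟩
  rintro _ ⟨_, ⟨x, f, hx, hf, -, rfl⟩, rfl⟩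
  calc ‖f (T x)‖ ≤ ‖f‖ * (‖T‖ * ‖x‖) := f.le_opNorm_of_le (T.le_opNorm x)
    _ = ‖T‖ := by rw [hx, hf]; ring

theorem numericalRadius_nonneg (T : E →L[𝕜] E) : 0 ≤ numericalRadius 𝕜 T := by
  refine Real.sSup_nonneg ?_
  rintro _ ⟨_, -, rfl⟩
  exact norm_nonneg _

theorem numericalRadius_smul_le (T : E →L[𝕜] E) {c : 𝕜} (hc : ‖c‖ = 1) :
    numericalRadius 𝕜 (c • T) ≤ numericalRadius 𝕜 T := by
  refine Real.sSup_le ?_ (numericalRadius_nonneg T)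
  rintro _ ⟨_, ⟨x, f, hx, hf, hfx, rfl⟩, rfl⟩
  refine le_csSup (bddAbove_norm_numericalRange T) ⟨f (T x), ⟨x, f, hx, hf, hfx, rfl⟩, ?_⟩
  simp [hc]

/-- The numerical radius controls how far `1 - a • T` can contract a vector. -/
theorem le_norm_sub_smul_apply (T : E →L[𝕜] E) {a : ℝ} (ha : 0 ≤ a) (x : E) :
    (1 - a * numericalRadius 𝕜 T) * ‖x‖ ≤ ‖x - (a : 𝕜) • T x‖ := by
  rcases eq_or_ne x 0 with rfl | hx
  · simp
  -- With `f` norming `x`, the pair `x / ‖x‖`, `f` yields a point of the numerical range; evaluating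
  -- `f` at `x - a • T x` then bounds its norm from below.
  obtain ⟨f, hf, hfx⟩ := exists_dual_vector 𝕜 x (norm_ne_zero_iff.2 hx)
  have hx' : ‖x‖ ≠ 0 := norm_ne_zero_iff.2 hx
  have hxk : (‖x‖ : 𝕜) ≠ 0 := by exact_mod_cast hx'
  have hv : ‖f (T x)‖ ≤ numericalRadius 𝕜 T * ‖x‖ := by
    have : ‖f (T ((‖x‖ : 𝕜)⁻¹ • x))‖ ≤ numericalRadius 𝕜 T := by
      refine le_csSup (bddAbove_norm_numericalRange T) ⟨_, ⟨(‖x‖ : 𝕜)⁻¹ • x, f, ?_, hf, ?_, rfl⟩, rfl⟩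
      · simp [norm_smul, hx']
      · simp [hfx, hxk]
    rw [map_smul, map_smul, norm_smul, norm_inv, RCLike.norm_coe_norm,
      inv_mul_le_iff₀ (norm_pos_iff.2 hx)] at this
    linarith
  calc (1 - a * numericalRadius 𝕜 T) * ‖x‖ ≤ ‖x‖ - a * ‖f (T x)‖ := by nlinarith
    _ = ‖f x‖ - ‖(a : 𝕜) • f (T x)‖ := by
      rw [hfx, norm_smul, RCLike.norm_coe_norm, RCLike.norm_ofReal, abs_of_nonneg ha]
    _ ≤ ‖f x - (a : 𝕜) • f (T x)‖ := norm_sub_norm_le _ _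
    _ = ‖f (x - (a : 𝕜) • T x)‖ := by rw [map_sub, map_smul]
    _ ≤ ‖f‖ * ‖x - (a : 𝕜) • T x‖ := f.le_opNorm _
    _ = ‖x - (a : 𝕜) • T x‖ := by rw [hf, one_mul]

/-- Lumer's estimate. -/
theorem norm_one_add_smul_le (T : E →L[𝕜] E) {a : ℝ} (ha : 0 ≤ a)
    (hav : a * numericalRadius 𝕜 T < 1) :
    (1 - a * numericalRadius 𝕜 T) * ‖1 + (a : 𝕜) • T‖ ≤ 1 + a ^ 2 * ‖T‖ ^ 2 := by
  have hpos : 0 < 1 - a * numericalRadius 𝕜 T := by linarith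
  rw [← le_div_iff₀' hpos]
  refine ContinuousLinearMap.opNorm_le_bound _ (by positivity) fun x => ?_
  rw [div_mul_eq_mul_div, le_div_iff₀' hpos]
  -- The bound is applied to `(1 + aT) x`, because `(1 - aT)(1 + aT) = 1 - a² T²` has no first order
  -- term.
  refine (le_norm_sub_smul_apply T ha _).trans ?_
  have : (1 + (a : 𝕜) • T) x - (a : 𝕜) • T ((1 + (a : 𝕜) • T) x)
      = x - (a : 𝕜) ^ 2 • T (T x) := by
    simp only [add_apply, one_apply_eq_self, smul_apply, map_add, map_smul, smul_add, smul_smul, pow_two]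
    abel
  rw [this]
  refine (norm_sub_le _ _).trans ?_
  rw [norm_smul, norm_pow, RCLike.norm_ofReal, sq_abs, add_mul, one_mul, mul_assoc]
  gcongr
  calc ‖T (T x)‖ ≤ ‖T‖ * (‖T‖ * ‖x‖) := T.le_opNorm_of_le (T.le_opNorm x)
    _ = ‖T‖ ^ 2 * ‖x‖ := by ring

open Filter Topology in
-- After rotating `S` so that `c` becomes `r = ‖c‖`, unitality and contractivity give `1 + a r ≤ ‖1
-- + a w S‖`. Lumer's estimate bounds the right side by `1 + a v + O(a²)`; compare first order terms
-- as `a → 0⁺`.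
theorem norm_le_numericalRadius_of_unital (Φ : (E →L[𝕜] E) →ₗ[𝕜] (F →L[𝕜] F)) (h1 : Φ 1 = 1)
    (hΦ : ∀ S, ‖Φ S‖ ≤ ‖S‖) (S : E →L[𝕜] E) {c : 𝕜} (hc : c ∈ numericalRange 𝕜 (Φ S)) :
    ‖c‖ ≤ numericalRadius 𝕜 S := by
  obtain ⟨z, g, hz, hg, hgz, rfl⟩ := hc
  obtain ⟨w, hw, hwc⟩ : ∃ w : 𝕜, ‖w‖ = 1 ∧ w * g (Φ S z) = ‖g (Φ S z)‖ := by
    rcases eq_or_ne (g (Φ S z)) 0 with h | h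
    · exact ⟨1, by simp, by simp [h]⟩
    · refine ⟨‖g (Φ S z)‖ / g (Φ S z), ?_, div_mul_cancel₀ _ h⟩
      rw [norm_div, RCLike.norm_coe_norm, div_self (norm_ne_zero_iff.2 h)]
  set r := ‖g (Φ S z)‖
  set v := numericalRadius 𝕜 S
  have key : ∀ a : ℝ, 0 < a → a * v < 1 → (1 - a * v) * r ≤ v + a * ‖S‖ ^ 2 := by
    intro a ha hav
    have hav' : a * numericalRadius 𝕜 (w • S) ≤ a * v := by
      gcongr; exact numericalRadius_smul_le S hw
    have hS := norm_one_add_smul_le (w • S) ha.le (hav'.trans_lt hav)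
    have hle : 1 + a * r ≤ ‖1 + (a : 𝕜) • w • S‖ := by
      have h2 : g (Φ (1 + (a : 𝕜) • w • S) z) = ((1 + a * r : ℝ) : 𝕜) := by
        simp [h1, hgz, hwc]
      calc 1 + a * r = ‖((1 + a * r : ℝ) : 𝕜)‖ := by
            rw [RCLike.norm_ofReal, abs_of_nonneg (by positivity)]
        _ = ‖g (Φ (1 + (a : 𝕜) • w • S) z)‖ := by rw [h2]
        _ ≤ ‖g‖ * (‖Φ (1 + (a : 𝕜) • w • S)‖ * ‖z‖) :=
            g.le_opNorm_of_le (ContinuousLinearMap.le_opNorm _ _)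
        _ ≤ _ := by rw [hg, hz, one_mul, mul_one]; exact hΦ _
    have hwS : ‖w • S‖ = ‖S‖ := by rw [norm_smul, hw, one_mul]
    rw [hwS] at hS
    have h3 : (1 - a * v) * (1 + a * r) ≤ 1 + a ^ 2 * ‖S‖ ^ 2 :=
      (mul_le_mul (by linarith) hle (by positivity) (by linarith)).trans hS
    have h4 : a * ((1 - a * v) * r) ≤ a * (v + a * ‖S‖ ^ 2) := by nlinarith
    exact le_of_mul_le_mul_left h4 ha
  have t1 : Tendsto (fun a : ℝ => (1 - a * v) * r) (𝓝[>] 0) (𝓝 r) := by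
    have : Continuous fun a : ℝ => (1 - a * v) * r := by fun_prop
    simpa using (this.tendsto 0).mono_left nhdsWithin_le_nhds
  have t2 : Tendsto (fun a : ℝ => v + a * ‖S‖ ^ 2) (𝓝[>] 0) (𝓝 v) := by
    have : Continuous fun a : ℝ => v + a * ‖S‖ ^ 2 := by fun_prop
    simpa using (this.tendsto 0).mono_left nhdsWithin_le_nhds
  have t3 : ∀ᶠ a : ℝ in 𝓝[>] 0, a * v < 1 := by
    have : Continuous fun a : ℝ => a * v := by fun_prop
    exact ((this.tendsto 0).mono_left nhdsWithin_le_nhds).eventually_lt_const (by simp)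
  refine le_of_tendsto_of_tendsto t1 t2 ?_
  filter_upwards [t3, self_mem_nhdsWithin] with a ha ha0 using key a ha0 ha

/-- A unital linear isometry between algebras of operators does not increase the
numerical index. -/
theorem numericalIndex_le_of_unital [Nontrivial E] (Φ : (E →L[𝕜] E) →ₗ[𝕜] (F →L[𝕜] F))
    (h1 : Φ 1 = 1) (hΦ : ∀ S, ‖Φ S‖ = ‖S‖) : numericalIndex 𝕜 F ≤ numericalIndex 𝕜 E := by
  -- The identity shows that the infimum is not over the empty set, where `sInf` would be `0`.
  refine le_csInf ⟨_, 1, norm_one, rfl⟩ ?_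
  rintro _ ⟨S, hS, rfl⟩
  have hbdd : BddBelow {r : ℝ | ∃ T : F →L[𝕜] F, ‖T‖ = 1 ∧ r = numericalRadius 𝕜 T} := by
    refine ⟨0, ?_⟩
    rintro _ ⟨T, -, rfl⟩
    exact numericalRadius_nonneg T
  refine (csInf_le hbdd ⟨Φ S, (hΦ S).trans hS, rfl⟩).trans ?_
  refine Real.sSup_le ?_ (numericalRadius_nonneg S)
  rintro _ ⟨c, hc, rfl⟩
  exact norm_le_numericalRadius_of_unital Φ h1 (fun S => (hΦ S).le) S hc

theorem numericalIndex_le_of_linearIsometryEquiv [Nontrivial E] (e : E ≃ₗᵢ[𝕜] F) :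
    numericalIndex 𝕜 F ≤ numericalIndex 𝕜 E := by
  refine numericalIndex_le_of_unital
    { toFun := fun S => (e : E →L[𝕜] F) ∘L S ∘L (e.symm : F →L[𝕜] E)
      map_add' := fun S T => by ext; simp
      map_smul' := fun c S => by ext; simp } (by ext; simp) fun S => ?_
  refine le_antisymm (ContinuousLinearMap.opNorm_le_bound _ (norm_nonneg _) fun x => ?_)
    (ContinuousLinearMap.opNorm_le_bound _ (norm_nonneg _) fun x => ?_)
  · simpa using S.le_opNorm (e.symm x)
  · simpa using ContinuousLinearMap.le_opNorm
      ((e : E →L[𝕜] F) ∘L S ∘L (e.symm : F →L[𝕜] E)) (e x)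

/-- Left composition `T ↦ S ∘ T` is unital in `S`; it is isometric because on `g ⊗ x` with `‖g‖ = 1`
it returns `g ⊗ S x`. -/
theorem numericalIndex_continuousLinearMap_le [Nontrivial E] [Nontrivial F] :
    numericalIndex 𝕜 (F →L[𝕜] E) ≤ numericalIndex 𝕜 E := by
  refine numericalIndex_le_of_unital
    (ContinuousLinearMap.compL 𝕜 F E E : (E →L[𝕜] E) →ₗ[𝕜] _) (by ext; simp) fun S => ?_
  obtain ⟨y, hy⟩ := exists_ne (0 : F)
  obtain ⟨g, hg, -⟩ := exists_dual_vector 𝕜 y (norm_ne_zero_iff.2 hy)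
  refine le_antisymm (ContinuousLinearMap.opNorm_le_bound _ (norm_nonneg _) fun T => ?_)
    (ContinuousLinearMap.opNorm_le_bound _ (norm_nonneg _) fun x => ?_)
  · exact S.opNorm_comp_le T
  · have h := ContinuousLinearMap.le_opNorm (ContinuousLinearMap.compL 𝕜 F E E S)
      (ContinuousLinearMap.smulRight g x)
    have h2 : ContinuousLinearMap.compL 𝕜 F E E S (ContinuousLinearMap.smulRight g x)
        = ContinuousLinearMap.smulRight g (S x) := by ext; simp
    rw [h2, ContinuousLinearMap.norm_smulRight_apply, ContinuousLinearMap.norm_smulRight_apply,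
      hg, one_mul, one_mul] at h
    exact h

end NumericalIndexComparison

/-! ### Vanishing of tensor series under the approximation property. -/

section ApproximationProperty

open Filter Topology

/-- The square roots of the tails work: `b n = r n - r (n + 1)` factors as a difference of squares,
so `a n / √(r n)` is dominated by a telescoping series. -/
theorem exists_pos_tendsto_zero_summable_div {a : ℕ → ℝ} (ha : ∀ n, 0 ≤ a n) (hs : Summable a) :
    ∃ c : ℕ → ℝ, (∀ n, 0 < c n) ∧ Tendsto c atTop (𝓝 0) ∧ Summable fun n => a n / c n := by
  -- The geometric term keeps every tail strictly positive, even if `a` is eventually zero.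
  set b : ℕ → ℝ := fun n => a n + (1 / 2) ^ n
  have hb : Summable b := hs.add summable_geometric_two
  have hbpos : ∀ n, 0 < b n := fun n => add_pos_of_nonneg_of_pos (ha n) (by positivity)
  set r : ℕ → ℝ := fun n => ∑' k, b (k + n)
  have hr : ∀ n, r n = b n + r (n + 1) := by
    intro n
    have h := ((summable_nat_add_iff n).2 hb).tsum_eq_zero_add
    simp only [r, h, zero_add]
    congr 1
    exact tsum_congr fun k => by congr 1; ring
  have hr0 : ∀ n, 0 ≤ r n := fun n => tsum_nonneg fun k => (hbpos _).le
  have hrpos : ∀ n, 0 < r n := fun n => by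
    rw [hr]; exact add_pos_of_pos_of_nonneg (hbpos n) (hr0 _)
  refine ⟨fun n => √(r n), fun n => Real.sqrt_pos.2 (hrpos n), ?_, ?_⟩
  · have h := (Real.continuous_sqrt.tendsto 0).comp (tendsto_sum_nat_add b)
    rw [Real.sqrt_zero] at h
    exact h
  · have hle : ∀ n, a n / √(r n) ≤ 2 * √(r n) - 2 * √(r (n + 1)) := by
      intro n
      have h0 := Real.sqrt_pos.2 (hrpos n)
      have h1 := Real.sqrt_nonneg (r (n + 1))
      have h2 := Real.sq_sqrt (hr0 n)
      have h3 := Real.sq_sqrt (hr0 (n + 1))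
      have h4 := hr n
      have h5 : a n ≤ b n := le_add_of_nonneg_right (by positivity)
      rw [div_le_iff₀ h0]
      nlinarith [sq_nonneg (√(r n) - √(r (n + 1)))]
    refine summable_of_sum_range_le (c := 2 * √(r 0))
      (fun n => div_nonneg (ha n) (Real.sqrt_nonneg _)) fun n => ?_
    refine (Finset.sum_le_sum fun i _ => hle i).trans ?_
    rw [Finset.sum_range_sub']
    have := Real.sqrt_nonneg (r n)
    linarith

variable {𝕜 : Type*} [RCLike 𝕜] {U : Type*} [NormedAddCommGroup U] [NormedSpace 𝕜 U]
  {V : Type*} [NormedAddCommGroup V] [NormedSpace 𝕜 V]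
  {G : Type*} [NormedAddCommGroup G] [NormedSpace 𝕜 G]

theorem norm_bilinear_le (B : U →L[𝕜] V →L[𝕜] G) (u : U) (v : V) :
    ‖B u v‖ ≤ ‖B‖ * (‖u‖ * ‖v‖) := by
  rw [← mul_assoc]; exact B.le_opNorm₂ u v

theorem summable_bilinear [CompleteSpace G] (B : U →L[𝕜] V →L[𝕜] G) {u : ℕ → U} {v : ℕ → V}
    (hs : Summable fun n => ‖u n‖ * ‖v n‖) : Summable fun n => B (u n) (v n) :=
  (hs.mul_left ‖B‖).of_norm_bounded fun n => norm_bilinear_le B (u n) (v n)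

/-- Writing `T x = ∑ j, g j x • b j` reduces the series to finitely many images of the null series
`∑ g j (v n) • u n` under the maps `B · (b j)`. -/
theorem hasSum_bilinear_finiteRank (T : V →L[𝕜] V)
    [FiniteDimensional 𝕜 (LinearMap.range (T : V →ₗ[𝕜] V))] (B : U →L[𝕜] V →L[𝕜] G)
    {u : ℕ → U} {v : ℕ → V} (h0 : ∀ g : StrongDual 𝕜 V, HasSum (fun n => g (v n) • u n) 0) :
    HasSum (fun n => B (u n) (T (v n))) 0 := by
  let R := LinearMap.range (T : V →ₗ[𝕜] V)
  let b := Module.finBasis 𝕜 R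
  let Tr : V →L[𝕜] R := T.codRestrict R fun x => LinearMap.mem_range_self (T : V →ₗ[𝕜] V) x
  let g : Fin (Module.finrank 𝕜 R) → StrongDual 𝕜 V :=
    fun j => (LinearMap.toContinuousLinearMap (b.coord j)) ∘L Tr
  have hT : ∀ x, T x = ∑ j, g j x • (b j : V) := by
    intro x
    have h := congrArg (Subtype.val : R → V) (b.sum_repr (Tr x))
    rw [Submodule.coe_sum] at h
    exact h.symm
  have hsum := hasSum_sum (s := Finset.univ) fun j _ =>
    (h0 (g j)).mapL (B.flip (b j : V))
  simp only [map_zero, Finset.sum_const_zero] at hsum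
  refine hsum.congr_fun fun n => ?_
  rw [hT, map_sum]
  exact Finset.sum_congr rfl fun j _ => by simp

/-- In the presence of the approximation property, an absolutely convergent tensor series that
vanishes as an operator vanishes on every bounded bilinear map. -/
theorem HasApproximationProperty.tsum_bilinear_eq_zero [CompleteSpace G]
    (hV : HasApproximationProperty 𝕜 V) (B : U →L[𝕜] V →L[𝕜] G) {u : ℕ → U} {v : ℕ → V}
    (hs : Summable fun n => ‖u n‖ * ‖v n‖)
    (h0 : ∀ g : StrongDual 𝕜 V, HasSum (fun n => g (v n) • u n) 0) :
    ∑' n, B (u n) (v n) = 0 := by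
  obtain ⟨c, hc, hc0, hcs⟩ :=
    exists_pos_tendsto_zero_summable_div (fun n => by positivity) hs
  -- Rescaling to norm at most `c n` makes `w` a null sequence, so its range together with `0` is
  -- compact, while the coefficients `‖v n‖ / c n` stay summable against `‖u n‖`. If `v n = 0`, then
  -- `w n = 0`.
  set w : ℕ → V := fun n => ((c n / ‖v n‖ : ℝ) : 𝕜) • v n
  have hw : Tendsto w atTop (𝓝 0) := by
    refine squeeze_zero_norm (fun n => ?_) hc0
    rw [norm_smul, RCLike.norm_ofReal, abs_of_nonneg (div_nonneg (hc n).le (norm_nonneg _))]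
    rcases eq_or_ne ‖v n‖ 0 with h | h
    · simpa [h] using (hc n).le
    · rw [div_mul_cancel₀ _ h]
  have hvw : ∀ n, v n = ((‖v n‖ / c n : ℝ) : 𝕜) • w n := by
    intro n
    rcases eq_or_ne (v n) 0 with h | h
    · simp [w, h]
    · rw [smul_smul, ← RCLike.ofReal_mul, div_mul_div_comm, mul_comm, div_self, RCLike.ofReal_one,
        one_smul]
      exact mul_ne_zero (hc n).ne' (norm_ne_zero_iff.2 h)
  set A : ℝ := ∑' n, ‖u n‖ * ‖v n‖ / c n
  have hA : 0 ≤ A := tsum_nonneg fun n => div_nonneg (by positivity) (hc n).le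
  have key : ∀ ε : ℝ, 0 < ε → ‖∑' n, B (u n) (v n)‖ ≤ ‖B‖ * (A * ε) := by
    intro ε hε
    obtain ⟨T, hT, hTε⟩ := hV _ hw.isCompact_insert_range ε hε
    -- Subtracting this null series replaces `v n` by `v n - T (v n)`, which is small uniformly in
    -- the rescaled sense.
    have h1 := (summable_bilinear B hs).hasSum.sub (hasSum_bilinear_finiteRank T B h0)
    rw [sub_zero] at h1
    rw [← h1.tsum_eq]
    refine tsum_of_norm_bounded ((hcs.hasSum.mul_right ε).mul_left ‖B‖) fun n => ?_
    rw [← map_sub]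
    refine (norm_bilinear_le B _ _).trans ?_
    have h2 : ‖v n - T (v n)‖ ≤ ‖v n‖ / c n * ε := by
      have h3 : v n - T (v n) = ((‖v n‖ / c n : ℝ) : 𝕜) • (w n - T (w n)) := by
        rw [smul_sub, ← map_smul, ← hvw]
      rw [h3, norm_smul, RCLike.norm_ofReal,
        abs_of_nonneg (div_nonneg (norm_nonneg _) (hc n).le), norm_sub_rev]
      have h4 := hTε (w n) (Set.mem_insert_of_mem _ (Set.mem_range_self n))
      have h5 := div_nonneg (norm_nonneg (v n)) (hc n).le
      gcongr
    calc ‖B‖ * (‖u n‖ * ‖v n - T (v n)‖) ≤ ‖B‖ * (‖u n‖ * (‖v n‖ / c n * ε)) := by gcongr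
      _ = ‖B‖ * (‖u n‖ * ‖v n‖ / c n * ε) := by ring
  have ht : Tendsto (fun ε : ℝ => ‖B‖ * (A * ε)) (𝓝[>] 0) (𝓝 0) := by
    have : Continuous fun ε : ℝ => ‖B‖ * (A * ε) := by fun_prop
    simpa using (this.tendsto 0).mono_left nhdsWithin_le_nhds
  refine norm_le_zero_iff.1 (ge_of_tendsto ht ?_)
  filter_upwards [self_mem_nhdsWithin] with ε hε using key ε hε

end ApproximationProperty

/-! ### Independence of the nuclear representation. -/

section NuclearRepresentations

variable {𝕜 : Type*} [RCLike 𝕜] {X : Type*} [NormedAddCommGroup X] [NormedSpace 𝕜 X]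
  {Y : Type*} [NormedAddCommGroup Y] [NormedSpace 𝕜 Y]
  {G : Type*} [NormedAddCommGroup G] [NormedSpace 𝕜 G] [CompleteSpace G]

theorem IsNuclearRep.exists_add_bilinear {S T : X →L[𝕜] Y} {f g : ℕ → StrongDual 𝕜 X}
    {y z : ℕ → Y} (hf : IsNuclearRep S f y) (hg : IsNuclearRep T g z)
    (B : StrongDual 𝕜 X →L[𝕜] Y →L[𝕜] G) :
    ∃ (h : ℕ → StrongDual 𝕜 X) (w : ℕ → Y), IsNuclearRep (S + T) h w ∧
      ∑' n, B (h n) (w n) = ∑' n, B (f n) (y n) + ∑' n, B (g n) (z n) := by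
  obtain ⟨e⟩ : Nonempty (ℕ ≃ ℕ ⊕ ℕ) := ⟨Equiv.natSumNatEquivNat.symm⟩
  let F : ℕ ⊕ ℕ → StrongDual 𝕜 X := Sum.elim f g
  let W : ℕ ⊕ ℕ → Y := Sum.elim y z
  have h1 : HasSum (fun i => ‖F i‖ * ‖W i‖) _ :=
    HasSum.sum (f := fun i => ‖F i‖ * ‖W i‖) hf.summable.hasSum hg.summable.hasSum
  have h2 : HasSum (fun i => B (F i) (W i)) _ :=
    HasSum.sum (f := fun i => B (F i) (W i)) (summable_bilinear B hf.summable).hasSum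
      (summable_bilinear B hg.summable).hasSum
  refine ⟨fun n => F (e n), fun n => W (e n), ⟨((e.hasSum_iff).2 h1).summable, fun x => ?_⟩,
    ((e.hasSum_iff).2 h2).tsum_eq⟩
  have h3 : HasSum (fun i => F i x • W i) (S x + T x) :=
    HasSum.sum (f := fun i => F i x • W i) (hf.hasSum x) (hg.hasSum x)
  exact (e.hasSum_iff).2 h3

variable [CompleteSpace Y]

theorem IsNuclearRep.tsum_bilinear_eq_zero
    (hAP : HasApproximationProperty 𝕜 (StrongDual 𝕜 X) ∨ HasApproximationProperty 𝕜 Y)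
    {f : ℕ → StrongDual 𝕜 X} {y : ℕ → Y} (h : IsNuclearRep (0 : X →L[𝕜] Y) f y)
    (B : StrongDual 𝕜 X →L[𝕜] Y →L[𝕜] G) : ∑' n, B (f n) (y n) = 0 := by
  -- The hypothesis tests `f n` only against points of `X`. Norm convergence in `X*` upgrades this
  -- so that every `F` in `X**` can be applied, as the case of `X*` requires.
  have hY : ∀ g : StrongDual 𝕜 Y, HasSum (fun n => g (y n) • f n) 0 := by
    intro g
    have hs : Summable fun n => g (y n) • f n := by
      refine (h.summable.mul_left ‖g‖).of_norm_bounded fun n => ?_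
      rw [norm_smul]
      calc ‖g (y n)‖ * ‖f n‖ ≤ ‖g‖ * ‖y n‖ * ‖f n‖ := by gcongr; exact g.le_opNorm _
        _ = ‖g‖ * (‖f n‖ * ‖y n‖) := by ring
    have h0 : ∑' n, g (y n) • f n = 0 := by
      ext x
      have h1 := hs.hasSum.mapL (ContinuousLinearMap.apply 𝕜 𝕜 x)
      have h2 := (h.hasSum x).mapL g
      rw [zero_apply, map_zero] at h2
      refine h1.unique (h2.congr_fun fun n => ?_)
      simp [mul_comm]
    exact h0 ▸ hs.hasSum
  rcases hAP with hX | hY'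
  · have h1 := hX.tsum_bilinear_eq_zero B.flip (u := y) (v := f)
      (h.summable.congr fun n => mul_comm _ _) fun F => ?_
    · exact h1
    · have hs : Summable fun n => F (f n) • y n := by
        refine (h.summable.mul_left ‖F‖).of_norm_bounded fun n => ?_
        rw [norm_smul, ← mul_assoc]
        gcongr; exact F.le_opNorm _
      have h0 : ∑' n, F (f n) • y n = 0 := by
        refine SeparatingDual.eq_zero_of_forall_dual_eq_zero (R := 𝕜) fun g => ?_
        have h1 := hs.hasSum.mapL g
        have h2 := (hY g).mapL F
        rw [map_zero] at h2
        refine h1.unique (h2.congr_fun fun n => ?_)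
        simp [mul_comm]
      exact h0 ▸ hs.hasSum
  · exact hY'.tsum_bilinear_eq_zero B h.summable hY

/-- The value of a bounded bilinear map on a nuclear representation depends only on the
operator represented. -/
theorem IsNuclearRep.tsum_bilinear_eq
    (hAP : HasApproximationProperty 𝕜 (StrongDual 𝕜 X) ∨ HasApproximationProperty 𝕜 Y)
    {T : X →L[𝕜] Y} {f g : ℕ → StrongDual 𝕜 X} {y z : ℕ → Y} (hf : IsNuclearRep T f y)
    (hg : IsNuclearRep T g z) (B : StrongDual 𝕜 X →L[𝕜] Y →L[𝕜] G) :
    ∑' n, B (f n) (y n) = ∑' n, B (g n) (z n) := by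
  -- Interleaving one representation with the negative of the other represents `T - T = 0`.
  obtain ⟨h, w, hr, he⟩ := hf.exists_add_bilinear (hg.smul (-1)) B
  rw [neg_smul, one_smul, add_neg_cancel] at hr
  rw [hr.tsum_bilinear_eq_zero hAP B] at he
  simp only [neg_smul, one_smul, map_neg, tsum_neg] at he
  exact add_neg_eq_zero.1 he.symm

end NuclearRepresentations

/-! ### Rank one operators and their density. -/

section NuclearLift

open Filter Topology

variable {𝕜 : Type*} [RCLike 𝕜] {X : Type*} [NormedAddCommGroup X] [NormedSpace 𝕜 X]
  {Y : Type*} [NormedAddCommGroup Y] [NormedSpace 𝕜 Y]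
  {G : Type*} [NormedAddCommGroup G] [NormedSpace 𝕜 G]

theorem IsNuclear.le_mul_nuclearNorm {T : X →L[𝕜] Y} (hT : IsNuclear T) {a c : ℝ}
    (h : ∀ f y, IsNuclearRep T f y → a ≤ c * ∑' n, ‖f n‖ * ‖y n‖) : a ≤ c * nuclearNorm T := by
  have hcl : IsClosed {r : ℝ | a ≤ c * r} := isClosed_le (by fun_prop) (by fun_prop)
  refine hcl.closure_subset_iff.2 ?_ (csInf_mem_closure hT.values_nonempty (nuclearValues_bddBelow T))
  rintro r ⟨f, y, hr, rfl⟩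
  exact h f y hr

theorem IsNuclearRep.nuclearNorm_le {T : X →L[𝕜] Y} {f : ℕ → StrongDual 𝕜 X} {y : ℕ → Y}
    (h : IsNuclearRep T f y) : nuclearNorm T ≤ ∑' n, ‖f n‖ * ‖y n‖ :=
  csInf_le (nuclearValues_bddBelow T) ⟨f, y, h, rfl⟩

theorem isNuclearRep_smulRight (f : StrongDual 𝕜 X) (y : Y) :
    IsNuclearRep (f.smulRight y) (Pi.single 0 f) (Pi.single 0 y) := by
  refine ⟨summable_of_ne_finset_zero (s := {0}) fun n hn => ?_, fun x => ?_⟩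
  · have : n ≠ 0 := by simpa using hn
    simp [this]
  · have h := hasSum_single (f := fun n => (Pi.single 0 f : ℕ → StrongDual 𝕜 X) n x •
      (Pi.single 0 y : ℕ → Y) n) 0 fun n hn => by simp [hn]
    simpa using h

/-- The rank one operator `f ⊗ y` as a nuclear operator. -/
def NuclearOperator.rankOne (f : StrongDual 𝕜 X) (y : Y) : NuclearOperator 𝕜 X Y :=
  (⟨f.smulRight y, _, _, isNuclearRep_smulRight f y⟩ : nuclearSubmodule 𝕜 X Y)

theorem NuclearOperator.toCLM_rankOne (f : StrongDual 𝕜 X) (y : Y) :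
    NuclearOperator.toCLM 𝕜 X Y (NuclearOperator.rankOne f y) = f.smulRight y := rfl

theorem NuclearOperator.norm_rankOne (f : StrongDual 𝕜 X) (y : Y) :
    ‖NuclearOperator.rankOne f y‖ = ‖f‖ * ‖y‖ := by
  refine le_antisymm ?_ ?_
  · refine (isNuclearRep_smulRight f y).nuclearNorm_le.trans_eq ?_
    rw [tsum_eq_single 0 fun n hn => by simp [hn]]
    simp
  · rw [← ContinuousLinearMap.norm_smulRight_apply]
    exact (NuclearOperator.rankOne f y).isNuclear.norm_le_nuclearNorm

/-- The tail of a representation represents the remainder, so its nuclear norm is at most a tail of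
a convergent series. -/
theorem IsNuclearRep.tendsto_sum_rankOne {T : NuclearOperator 𝕜 X Y} {f : ℕ → StrongDual 𝕜 X}
    {y : ℕ → Y} (h : IsNuclearRep (NuclearOperator.toCLM 𝕜 X Y T) f y) :
    Tendsto (fun n => ∑ i ∈ Finset.range n, NuclearOperator.rankOne (f i) (y i)) atTop (𝓝 T) := by
  rw [tendsto_iff_norm_sub_tendsto_zero]
  refine squeeze_zero (fun n => norm_nonneg _) (fun n => ?_)
    (tendsto_sum_nat_add fun n => ‖f n‖ * ‖y n‖)
  rw [norm_sub_rev]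
  refine IsNuclearRep.nuclearNorm_le ⟨(summable_nat_add_iff n).2 h.summable, fun x => ?_⟩
  have h1 := (hasSum_nat_add_iff' n).2 (h.hasSum x)
  rw [map_sub, map_sum]
  simpa [NuclearOperator.toCLM_rankOne] using h1

theorem NuclearOperator.rankOne_add_left (f g : StrongDual 𝕜 X) (y : Y) :
    NuclearOperator.rankOne (f + g) y
      = NuclearOperator.rankOne f y + NuclearOperator.rankOne g y :=
  NuclearOperator.toCLM_injective (by
    ext; simp [NuclearOperator.toCLM_rankOne, add_smul])

theorem NuclearOperator.rankOne_add_right (f : StrongDual 𝕜 X) (y z : Y) :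
    NuclearOperator.rankOne f (y + z)
      = NuclearOperator.rankOne f y + NuclearOperator.rankOne f z :=
  NuclearOperator.toCLM_injective (by ext; simp [NuclearOperator.toCLM_rankOne])

theorem NuclearOperator.rankOne_smul_left (c : 𝕜) (f : StrongDual 𝕜 X) (y : Y) :
    NuclearOperator.rankOne (c • f) y = c • NuclearOperator.rankOne f y :=
  NuclearOperator.toCLM_injective (by
    ext; simp [NuclearOperator.toCLM_rankOne, mul_smul])

theorem NuclearOperator.rankOne_smul_right (c : 𝕜) (f : StrongDual 𝕜 X) (y : Y) :
    NuclearOperator.rankOne f (c • y) = c • NuclearOperator.rankOne f y :=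
  NuclearOperator.toCLM_injective (by
    ext; simp [NuclearOperator.toCLM_rankOne, smul_comm c])

/-- Bounded operators on `N(X, Y)` are determined by their values on rank one operators. -/
theorem NuclearOperator.clm_ext {H : Type*} [NormedAddCommGroup H] [NormedSpace 𝕜 H]
    {φ ψ : NuclearOperator 𝕜 X Y →L[𝕜] H}
    (h : ∀ f y, φ (NuclearOperator.rankOne f y) = ψ (NuclearOperator.rankOne f y)) : φ = ψ := by
  ext T
  obtain ⟨f, y, hT⟩ := T.isNuclear
  have h1 := (φ.continuous.tendsto T).comp hT.tendsto_sum_rankOne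
  have h2 := (ψ.continuous.tendsto T).comp hT.tendsto_sum_rankOne
  refine tendsto_nhds_unique h1 (h2.congr fun n => ?_)
  simp [h]

/-! ### Lifting bounded bilinear maps to the nuclear operators. -/

variable [CompleteSpace Y] [CompleteSpace G]

/-- The sum of a bounded bilinear map along a chosen nuclear representation. -/
def nuclearTsum (B : StrongDual 𝕜 X →L[𝕜] Y →L[𝕜] G) (T : NuclearOperator 𝕜 X Y) : G :=
  ∑' n, B (T.isNuclear.choose n) (T.isNuclear.choose_spec.choose n)

theorem hasSum_nuclearTsum
    (hAP : HasApproximationProperty 𝕜 (StrongDual 𝕜 X) ∨ HasApproximationProperty 𝕜 Y)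
    (B : StrongDual 𝕜 X →L[𝕜] Y →L[𝕜] G) {T : NuclearOperator 𝕜 X Y}
    {f : ℕ → StrongDual 𝕜 X} {y : ℕ → Y}
    (h : IsNuclearRep (NuclearOperator.toCLM 𝕜 X Y T) f y) :
    HasSum (fun n => B (f n) (y n)) (nuclearTsum B T) := by
  have h1 : ∑' n, B (f n) (y n) = nuclearTsum B T :=
    h.tsum_bilinear_eq hAP T.isNuclear.choose_spec.choose_spec B
  exact h1 ▸ (summable_bilinear B h.summable).hasSum

theorem nuclearTsum_add
    (hAP : HasApproximationProperty 𝕜 (StrongDual 𝕜 X) ∨ HasApproximationProperty 𝕜 Y)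
    (B : StrongDual 𝕜 X →L[𝕜] Y →L[𝕜] G) (S T : NuclearOperator 𝕜 X Y) :
    nuclearTsum B (S + T) = nuclearTsum B S + nuclearTsum B T := by
  obtain ⟨f, y, hS⟩ := S.isNuclear
  obtain ⟨g, z, hT⟩ := T.isNuclear
  obtain ⟨h, w, hST, he⟩ := hS.exists_add_bilinear hT B
  rw [← map_add] at hST
  rwa [(hasSum_nuclearTsum hAP B hST).tsum_eq, (hasSum_nuclearTsum hAP B hS).tsum_eq,
    (hasSum_nuclearTsum hAP B hT).tsum_eq] at he

theorem nuclearTsum_smul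
    (hAP : HasApproximationProperty 𝕜 (StrongDual 𝕜 X) ∨ HasApproximationProperty 𝕜 Y)
    (B : StrongDual 𝕜 X →L[𝕜] Y →L[𝕜] G) (c : 𝕜)
    (T : NuclearOperator 𝕜 X Y) : nuclearTsum B (c • T) = c • nuclearTsum B T := by
  obtain ⟨f, y, hT⟩ := T.isNuclear
  have hcT := hT.smul c
  rw [← map_smul] at hcT
  refine (hasSum_nuclearTsum hAP B hcT).unique ?_
  simpa using (hasSum_nuclearTsum hAP B hT).const_smul c

theorem norm_nuclearTsum_le
    (hAP : HasApproximationProperty 𝕜 (StrongDual 𝕜 X) ∨ HasApproximationProperty 𝕜 Y)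
    (B : StrongDual 𝕜 X →L[𝕜] Y →L[𝕜] G) (T : NuclearOperator 𝕜 X Y) :
    ‖nuclearTsum B T‖ ≤ ‖B‖ * ‖T‖ := by
  refine T.isNuclear.le_mul_nuclearNorm fun f y h => ?_
  rw [← (hasSum_nuclearTsum hAP B h).tsum_eq]
  exact tsum_of_norm_bounded (h.summable.hasSum.mul_left ‖B‖)
    fun n => norm_bilinear_le B (f n) (y n)

variable (hAP : HasApproximationProperty 𝕜 (StrongDual 𝕜 X) ∨ HasApproximationProperty 𝕜 Y)

/-- The bounded operator on `N(X, Y)` induced by a bounded bilinear map on `X⋆ × Y`. -/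
def nuclearLift (B : StrongDual 𝕜 X →L[𝕜] Y →L[𝕜] G) : NuclearOperator 𝕜 X Y →L[𝕜] G :=
  LinearMap.mkContinuous
    { toFun := nuclearTsum B
      map_add' := nuclearTsum_add hAP B
      map_smul' := nuclearTsum_smul hAP B }
    ‖B‖ (norm_nuclearTsum_le hAP B)

theorem norm_nuclearLift_le (B : StrongDual 𝕜 X →L[𝕜] Y →L[𝕜] G) : ‖nuclearLift hAP B‖ ≤ ‖B‖ :=
  ContinuousLinearMap.opNorm_le_bound _ (norm_nonneg B) (norm_nuclearTsum_le hAP B)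

theorem hasSum_nuclearLift (B : StrongDual 𝕜 X →L[𝕜] Y →L[𝕜] G) {T : NuclearOperator 𝕜 X Y}
    {f : ℕ → StrongDual 𝕜 X} {y : ℕ → Y}
    (h : IsNuclearRep (NuclearOperator.toCLM 𝕜 X Y T) f y) :
    HasSum (fun n => B (f n) (y n)) (nuclearLift hAP B T) :=
  hasSum_nuclearTsum hAP B h

theorem nuclearLift_rankOne (B : StrongDual 𝕜 X →L[𝕜] Y →L[𝕜] G) (f : StrongDual 𝕜 X) (y : Y) :
    nuclearLift hAP B (NuclearOperator.rankOne f y) = B f y := by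
  have h := hasSum_nuclearLift hAP B (T := NuclearOperator.rankOne f y) (isNuclearRep_smulRight f y)
  refine h.unique ?_
  have h1 := hasSum_single (f := fun n => B ((Pi.single 0 f : ℕ → StrongDual 𝕜 X) n)
      ((Pi.single 0 y : ℕ → Y) n)) 0 fun n hn => by simp [hn]
  simpa using h1

theorem norm_nuclearLift (B : StrongDual 𝕜 X →L[𝕜] Y →L[𝕜] G) : ‖nuclearLift hAP B‖ = ‖B‖ := by
  refine le_antisymm (norm_nuclearLift_le hAP B) ?_
  refine B.opNorm_le_bound₂ (norm_nonneg _) fun f y => ?_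
  have h := (nuclearLift hAP B).le_opNorm (NuclearOperator.rankOne f y)
  rwa [nuclearLift_rankOne, NuclearOperator.norm_rankOne, ← mul_assoc] at h

theorem nuclearLift_add (B C : StrongDual 𝕜 X →L[𝕜] Y →L[𝕜] G) :
    nuclearLift hAP (B + C) = nuclearLift hAP B + nuclearLift hAP C :=
  NuclearOperator.clm_ext fun f y => by simp [nuclearLift_rankOne]

theorem nuclearLift_smul (c : 𝕜) (B : StrongDual 𝕜 X →L[𝕜] Y →L[𝕜] G) :
    nuclearLift hAP (c • B) = c • nuclearLift hAP B :=
  NuclearOperator.clm_ext fun f y => by simp [nuclearLift_rankOne]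

/-- `nuclearLift` as a linear isometry. -/
def nuclearLiftIsometry :
    (StrongDual 𝕜 X →L[𝕜] Y →L[𝕜] G) →ₗᵢ[𝕜] (NuclearOperator 𝕜 X Y →L[𝕜] G) where
  toFun := nuclearLift hAP
  map_add' := nuclearLift_add hAP
  map_smul' := nuclearLift_smul hAP
  norm_map' := norm_nuclearLift hAP

theorem nuclearLift_surjective : Function.Surjective (nuclearLift (G := G) hAP) := by
  intro φ
  let B : StrongDual 𝕜 X →L[𝕜] Y →L[𝕜] G :=
    LinearMap.mkContinuous₂
      (LinearMap.mk₂ 𝕜 (fun f y => φ (NuclearOperator.rankOne f y))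
        (fun f g y => by rw [NuclearOperator.rankOne_add_left, map_add])
        (fun c f y => by rw [NuclearOperator.rankOne_smul_left, map_smul])
        (fun f y z => by rw [NuclearOperator.rankOne_add_right, map_add])
        (fun c f y => by rw [NuclearOperator.rankOne_smul_right, map_smul]))
      ‖φ‖ fun f y => by
        rw [mul_assoc, ← NuclearOperator.norm_rankOne]
        exact φ.le_opNorm _
  exact ⟨B, NuclearOperator.clm_ext fun f y => nuclearLift_rankOne hAP B f y⟩

/-- Bounded operators on `N(X, Y)` are the bounded bilinear maps on `X⋆ × Y`. -/
def nuclearLiftEquiv :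
    (StrongDual 𝕜 X →L[𝕜] Y →L[𝕜] G) ≃ₗᵢ[𝕜] (NuclearOperator 𝕜 X Y →L[𝕜] G) :=
  LinearIsometryEquiv.ofSurjective (F := StrongDual 𝕜 X →L[𝕜] Y →L[𝕜] G)
    (E₂ := NuclearOperator 𝕜 X Y →L[𝕜] G) (nuclearLiftIsometry hAP) (nuclearLift_surjective hAP)

/-! ### The bounds for the dual, the operators `S ⊗ R`, and the bounds for the space itself. -/

theorem numericalIndex_dual_nuclearOperator_le_dual [Nontrivial X] [Nontrivial Y]
    (hAP : HasApproximationProperty 𝕜 (StrongDual 𝕜 X) ∨ HasApproximationProperty 𝕜 Y) :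
    numericalIndex 𝕜 (StrongDual 𝕜 (NuclearOperator 𝕜 X Y)) ≤
      numericalIndex 𝕜 (StrongDual 𝕜 Y) :=
  (numericalIndex_le_of_linearIsometryEquiv (nuclearLiftEquiv (G := 𝕜) hAP)).trans
    numericalIndex_continuousLinearMap_le

theorem numericalIndex_dual_nuclearOperator_le_bidual [Nontrivial X] [Nontrivial Y]
    (hAP : HasApproximationProperty 𝕜 (StrongDual 𝕜 X) ∨ HasApproximationProperty 𝕜 Y) :
    numericalIndex 𝕜 (StrongDual 𝕜 (NuclearOperator 𝕜 X Y)) ≤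
      numericalIndex 𝕜 (StrongDual 𝕜 (StrongDual 𝕜 X)) :=
  (numericalIndex_le_of_linearIsometryEquiv
    ((ContinuousLinearMap.flipₗᵢ 𝕜 Y (StrongDual 𝕜 X) 𝕜).trans (nuclearLiftEquiv (G := 𝕜) hAP))).trans
    numericalIndex_continuousLinearMap_le

/-- The bilinear map `(f, y) ↦ S f ⊗ R y`. -/
def rankOneBilinear (S : StrongDual 𝕜 X →L[𝕜] StrongDual 𝕜 X) (R : Y →L[𝕜] Y) :
    StrongDual 𝕜 X →L[𝕜] Y →L[𝕜] X →L[𝕜] Y :=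
  (ContinuousLinearMap.smulRightL 𝕜 X Y).bilinearComp S R

theorem isNuclearRep_nuclearLift (S : StrongDual 𝕜 X →L[𝕜] StrongDual 𝕜 X) (R : Y →L[𝕜] Y)
    {T : NuclearOperator 𝕜 X Y} {f : ℕ → StrongDual 𝕜 X} {y : ℕ → Y}
    (h : IsNuclearRep (NuclearOperator.toCLM 𝕜 X Y T) f y) :
    IsNuclearRep (nuclearLift hAP (rankOneBilinear S R) T) (fun n => S (f n)) (fun n => R (y n)) := by
  refine ⟨?_, fun x => ?_⟩
  · refine (h.summable.mul_left (‖S‖ * ‖R‖)).of_nonneg_of_le (fun n => by positivity) fun n => ?_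
    rw [mul_mul_mul_comm]
    gcongr
    · exact S.le_opNorm _
    · exact R.le_opNorm _
  · exact (hasSum_nuclearLift hAP (rankOneBilinear S R) h).mapL (ContinuousLinearMap.apply 𝕜 Y x)

/-- The operator `S ⊗ R` on `N(X, Y)`, mapping `f ⊗ y` to `S f ⊗ R y`. -/
def nuclearMap (S : StrongDual 𝕜 X →L[𝕜] StrongDual 𝕜 X) (R : Y →L[𝕜] Y) :
    NuclearOperator 𝕜 X Y →L[𝕜] NuclearOperator 𝕜 X Y :=
  LinearMap.mkContinuous
    -- The lift is taken into `X →L[𝕜] Y`, which is complete because `Y` is, and then restricted;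
    -- completeness of the nuclear norm is thus not needed. The nuclear bound comes from the
    -- transformed representation.
    (LinearMap.codRestrict (nuclearSubmodule 𝕜 X Y)
      (nuclearLift hAP (rankOneBilinear S R) : NuclearOperator 𝕜 X Y →ₗ[𝕜] X →L[𝕜] Y) fun T => by
        obtain ⟨f, y, h⟩ := T.isNuclear
        exact ⟨_, _, isNuclearRep_nuclearLift hAP S R h⟩)
    (‖S‖ * ‖R‖) fun T => by
      refine T.isNuclear.le_mul_nuclearNorm fun f y h => ?_
      have h1 := isNuclearRep_nuclearLift hAP S R h
      refine h1.nuclearNorm_le.trans ?_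
      rw [← tsum_mul_left]
      refine h1.summable.tsum_le_tsum (fun n => ?_) (h.summable.mul_left _)
      rw [mul_mul_mul_comm]
      gcongr
      · exact S.le_opNorm _
      · exact R.le_opNorm _

theorem norm_nuclearMap_le (S : StrongDual 𝕜 X →L[𝕜] StrongDual 𝕜 X) (R : Y →L[𝕜] Y) :
    ‖nuclearMap hAP S R‖ ≤ ‖S‖ * ‖R‖ :=
  LinearMap.mkContinuous_norm_le _ (by positivity) _

theorem nuclearMap_rankOne (S : StrongDual 𝕜 X →L[𝕜] StrongDual 𝕜 X) (R : Y →L[𝕜] Y)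
    (f : StrongDual 𝕜 X) (y : Y) :
    nuclearMap hAP S R (NuclearOperator.rankOne f y) = NuclearOperator.rankOne (S f) (R y) :=
  NuclearOperator.toCLM_injective (nuclearLift_rankOne hAP (rankOneBilinear S R) f y)

theorem numericalIndex_nuclearOperator_le_dual [Nontrivial X] [Nontrivial Y]
    (hAP : HasApproximationProperty 𝕜 (StrongDual 𝕜 X) ∨ HasApproximationProperty 𝕜 Y) :
    numericalIndex 𝕜 (NuclearOperator 𝕜 X Y) ≤ numericalIndex 𝕜 (StrongDual 𝕜 X) := by
  refine numericalIndex_le_of_unital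
    { toFun := fun S => nuclearMap hAP S 1
      map_add' := fun S T => NuclearOperator.clm_ext fun f y => by
        simp [nuclearMap_rankOne, NuclearOperator.rankOne_add_left]
      map_smul' := fun c S => NuclearOperator.clm_ext fun f y => by
        simp [nuclearMap_rankOne, NuclearOperator.rankOne_smul_left] }
    (NuclearOperator.clm_ext fun f y => by simp [nuclearMap_rankOne]) fun S => ?_
  refine le_antisymm ((norm_nuclearMap_le hAP S 1).trans (by simp)) ?_
  refine S.opNorm_le_bound (norm_nonneg _) fun f => ?_
  -- Testing on `f ⊗ y` with a fixed `y ≠ 0` and cancelling `‖y‖` recovers `‖S f‖`.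
  obtain ⟨y, hy⟩ := exists_ne (0 : Y)
  have h := (nuclearMap hAP S 1).le_opNorm (NuclearOperator.rankOne f y)
  rw [nuclearMap_rankOne, NuclearOperator.norm_rankOne, NuclearOperator.norm_rankOne,
    one_apply_eq_self, ← mul_assoc] at h
  exact le_of_mul_le_mul_right h (norm_pos_iff.2 hy)

theorem numericalIndex_nuclearOperator_le [Nontrivial X] [Nontrivial Y]
    (hAP : HasApproximationProperty 𝕜 (StrongDual 𝕜 X) ∨ HasApproximationProperty 𝕜 Y) :
    numericalIndex 𝕜 (NuclearOperator 𝕜 X Y) ≤ numericalIndex 𝕜 Y := by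
  refine numericalIndex_le_of_unital
    { toFun := fun R => nuclearMap hAP 1 R
      map_add' := fun S T => NuclearOperator.clm_ext fun f y => by
        simp [nuclearMap_rankOne, NuclearOperator.rankOne_add_right]
      map_smul' := fun c S => NuclearOperator.clm_ext fun f y => by
        simp [nuclearMap_rankOne, NuclearOperator.rankOne_smul_right] }
    (NuclearOperator.clm_ext fun f y => by simp [nuclearMap_rankOne]) fun R => ?_
  refine le_antisymm ((norm_nuclearMap_le hAP 1 R).trans (by simp)) ?_
  refine R.opNorm_le_bound (norm_nonneg _) fun y => ?_
  obtain ⟨f, hf⟩ := exists_ne (0 : StrongDual 𝕜 X)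
  have h := (nuclearMap hAP 1 R).le_opNorm (NuclearOperator.rankOne f y)
  rw [nuclearMap_rankOne, NuclearOperator.norm_rankOne, NuclearOperator.norm_rankOne,
    one_apply_eq_self, mul_left_comm] at h
  exact le_of_mul_le_mul_left h (norm_pos_iff.2 hf)

end NuclearLift

end

theorem mainTheorem9 {𝕜 : Type*} [RCLike 𝕜]
    {X : Type*} [NormedAddCommGroup X] [NormedSpace 𝕜 X] [CompleteSpace X] [Nontrivial X]
    {Y : Type*} [NormedAddCommGroup Y] [NormedSpace 𝕜 Y] [CompleteSpace Y] [Nontrivial Y]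
    (hAP : HasApproximationProperty 𝕜 (StrongDual 𝕜 X) ∨ HasApproximationProperty 𝕜 Y) :
    numericalIndex 𝕜 (NuclearOperator 𝕜 X Y) ≤
        min (numericalIndex 𝕜 (StrongDual 𝕜 X)) (numericalIndex 𝕜 Y) ∧
      numericalIndex 𝕜 (StrongDual 𝕜 (NuclearOperator 𝕜 X Y)) ≤
        min (numericalIndex 𝕜 (StrongDual 𝕜 (StrongDual 𝕜 X)))
          (numericalIndex 𝕜 (StrongDual 𝕜 Y)) :=
  ⟨le_min (numericalIndex_nuclearOperator_le_dual hAP) (numericalIndex_nuclearOperator_le hAP),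
    le_min (numericalIndex_dual_nuclearOperator_le_bidual hAP)
      (numericalIndex_dual_nuclearOperator_le_dual hAP)⟩
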